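/- Let $m>n\ge 1$ be integers, and let $G=G[V_1,V_2]$ be a finite simple bipartite graph with vertex set the disjoint union of $V_1$ and $V_2$, every edge joining $V_1$ to $V_2$, where $|V_1|=|V_2|=m+n-1$ and the minimum degree satisfies $\delta(G)>\frac34(m+n-1)$. For a graph $H$ and a positive integer $k$, a connected $k$-matching in $H$ is a matching with exactly $k$ edges, all lying in a single connected component of $H$. Then for every colouring of the edges of $G$ with the colours red and blue, the spanning subgraph of $G$ formed by all red edges contains a connected $m$-matching, or the spanning subgraph of $G$ formed by all blue edges contains a connected $n$-matching. -/

import Mathlib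

/-- The two colours of an edge-colouring. -/
inductive EdgeColor : Type
  | red
  | blue

/-- `H` contains a connected `k`-matching: a matching with exactly `k` edges, all of whose vertices
lie in one and the same connected component of `H`. -/
def HasConnectedMatching {V : Type*} (H : SimpleGraph V) (k : ℕ) : Prop :=
  ∃ (C : H.ConnectedComponent) (M : H.Subgraph),
    M.IsMatching ∧ M.edgeSet.encard = k ∧ M.verts ⊆ C.supp

/-- Every red-blue colouring of the edges of `G` yields a red connected `m`-matching or a blue
connected `n`-matching; components are taken in the spanning subgraph of all edges of the colour. -/
def ArrowsConnectedMatchings {V : Type*} (G : SimpleGraph V) (m n : ℕ) : Prop :=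
  ∀ c : G.EdgeLabeling EdgeColor,
    HasConnectedMatching (c.labelGraph EdgeColor.red) m ∨
      HasConnectedMatching (c.labelGraph EdgeColor.blue) n

/-! Suppose neither matching exists and put `N = m + n - 1`. By König's theorem each red component
has an edge cover of at most `s = m - 1` vertices, each blue one of at most `t = n - 1`; here `s + t
< N` and `2 * t < N`. Label each vertex by its red and blue components and call the vertices of one
side with given labels a cell.

Two vertices on one side have over `N / 2` common neighbours, so each side has a heavy cell, with
over `N / 4` vertices. A vertex opposite has a neighbour in it, hence shares a label with it. So the
two heavy cells share a label. If they share both, the two covers of that cell miss too many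
vertices (`false_of_common_heavy`). If they share one (`CrossHeavy`), each side splits into three
blocks, and the edges between suitable blocks lie in one component. Its cover contains a block or is
large (`subset_or_subset_or_lt`), and counting refutes every case. -/

open Finset

/-! ### Covers, heavy cells, and heavy cells with the same labels -/

section Core
open Classical

/-- A bipartite relation of large minimum degree, with both sides of size `N`. The vertices carry
two labels (`r`, `b` on the left, `r'`, `b'` on the right). Every edge lies inside a class of one of
the labels and meets a chosen vertex set of that class, given by `S`, `S'` (at most `s` vertices per
class) for the first label and by `T`, `T'` (at most `t` vertices per class) for the second. -/
structure CoveredBigraph (α β ι κ : Type*) [Fintype α] [Fintype β] (N s t : ℕ) where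
  adj : α → β → Prop
  r : α → ι
  r' : β → ι
  b : α → κ
  b' : β → κ
  S : ι → Finset α
  S' : ι → Finset β
  T : κ → Finset α
  T' : κ → Finset β
  card_left : Fintype.card α = N
  card_right : Fintype.card β = N
  deg_left : ∀ x, 3 * N < 4 * #{y | adj x y}
  deg_right : ∀ y, 3 * N < 4 * #{x | adj x y}
  card_S : ∀ i, #(S i) + #(S' i) ≤ s
  card_T : ∀ j, #(T j) + #(T' j) ≤ t
  add_lt : s + t < N
  cover : ∀ x y, adj x y → (r x = r' y ∧ (x ∈ S (r x) ∨ y ∈ S' (r x))) ∨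
    (b x = b' y ∧ (x ∈ T (b x) ∨ y ∈ T' (b x)))

namespace CoveredBigraph

variable {α β ι κ : Type*} [Fintype α] [Fintype β] {N s t : ℕ}

/-- Exchange the two sides. -/
def swapSides (D : CoveredBigraph α β ι κ N s t) : CoveredBigraph β α ι κ N s t where
  adj y x := D.adj x y
  r := D.r'
  r' := D.r
  b := D.b'
  b' := D.b
  S := D.S'
  S' := D.S
  T := D.T'
  T' := D.T
  card_left := D.card_right
  card_right := D.card_left
  deg_left := D.deg_right
  deg_right := D.deg_left
  card_S i := by rw [add_comm]; exact D.card_S i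
  card_T j := by rw [add_comm]; exact D.card_T j
  add_lt := D.add_lt
  cover y x h := by
    rcases D.cover x y h with ⟨h1, h2⟩ | ⟨h1, h2⟩
    · exact Or.inl ⟨h1.symm, h1 ▸ h2.symm⟩
    · exact Or.inr ⟨h1.symm, h1 ▸ h2.symm⟩

/-- Exchange the two labels. -/
def swapLabels (D : CoveredBigraph α β ι κ N s t) : CoveredBigraph α β κ ι N t s where
  adj := D.adj
  r := D.b
  r' := D.b'
  b := D.r
  b' := D.r'
  S := D.T
  S' := D.T'
  T := D.S
  T' := D.S'
  card_left := D.card_left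
  card_right := D.card_right
  deg_left := D.deg_left
  deg_right := D.deg_right
  card_S := D.card_T
  card_T := D.card_S
  add_lt := by have := D.add_lt; omega
  cover x y h := (D.cover x y h).symm

variable (D : CoveredBigraph α β ι κ N s t)
include D

lemma label_eq {x : α} {y : β} (h : D.adj x y) : D.r x = D.r' y ∨ D.b x = D.b' y := by
  rcases D.cover x y h with h | h
  · exact Or.inl h.1
  · exact Or.inr h.1

lemma card_nonadj_right {x : α} {Y : Finset β} (h : ∀ y ∈ Y, ¬ D.adj x y) : 4 * #Y < N := by
  have h1 : Y ⊆ univ \ univ.filter (fun y => D.adj x y) := fun y hy => by simp [h y hy]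
  have h2 := card_le_card h1
  rw [card_sdiff_of_subset (subset_univ _), card_univ, D.card_right] at h2
  have h3 := D.deg_left x
  have h4 := card_le_univ (univ.filter fun y => D.adj x y)
  rw [D.card_right] at h4
  omega

lemma card_nonadj_left {y : β} {X : Finset α} (h : ∀ x ∈ X, ¬ D.adj x y) : 4 * #X < N :=
  D.swapSides.card_nonadj_right h

/-- A cover of the edges between `P` and `Q` contains one of them or is large. -/
lemma subset_or_subset_or_lt {P U : Finset α} {Q U' : Finset β}
    (h : ∀ x ∈ P, ∀ y ∈ Q, D.adj x y → x ∈ U ∨ y ∈ U') :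
    P ⊆ U ∨ Q ⊆ U' ∨ 4 * #P + 4 * #Q < 4 * #U + 4 * #U' + 2 * N := by
  by_cases hP : P ⊆ U
  · exact Or.inl hP
  by_cases hQ : Q ⊆ U'
  · exact Or.inr (Or.inl hQ)
  obtain ⟨x, hxP, hxU⟩ := not_subset.1 hP
  obtain ⟨y, hyQ, hyU⟩ := not_subset.1 hQ
  -- The vertex `y` is uncovered, so it has no neighbour in `P \ U`.
  have h1 : 4 * #(P \ U) < N := D.card_nonadj_left (y := y) fun z hz hadj => by
    rw [mem_sdiff] at hz
    rcases h z hz.1 y hyQ hadj with h | h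
    exacts [hz.2 h, hyU h]
  have h2 : 4 * #(Q \ U') < N := D.card_nonadj_right (x := x) fun z hz hadj => by
    rw [mem_sdiff] at hz
    rcases h x hxP z hz.1 hadj with h | h
    exacts [hxU h, hz.2 h]
  have h3 := card_le_card_sdiff_add_card (s := P) (t := U)
  have h4 := card_le_card_sdiff_add_card (s := Q) (t := U')
  omega

lemma card_le_or_card_le_or_lt {P U : Finset α} {Q U' : Finset β}
    (h : ∀ x ∈ P, ∀ y ∈ Q, D.adj x y → x ∈ U ∨ y ∈ U') :
    #P ≤ #U ∨ #Q ≤ #U' ∨ 4 * #P + 4 * #Q < 4 * #U + 4 * #U' + 2 * N :=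
  (D.subset_or_subset_or_lt h).imp card_le_card (Or.imp_left card_le_card)

lemma false_of_cover (i : ι) (j : κ)
    (h : ∀ x y, D.adj x y → (x ∈ D.S i ∨ x ∈ D.T j) ∨ (y ∈ D.S' i ∨ y ∈ D.T' j)) : False := by
  have h1 := D.card_le_or_card_le_or_lt (P := univ) (Q := univ) (U := D.S i ∪ D.T j)
    (U' := D.S' i ∪ D.T' j) (fun x _ y _ hadj => by simpa using h x y hadj)
  rw [card_univ, card_univ, D.card_left, D.card_right] at h1
  have := card_union_le (D.S i) (D.T j)
  have := card_union_le (D.S' i) (D.T' j)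
  have := D.card_S i
  have := D.card_T j
  have := D.add_lt
  omega

lemma card_common_nbrs (x x' : α) : N < 2 * #{y | D.adj x y ∧ D.adj x' y} := by
  have h1 := D.deg_left x
  have h2 := D.deg_left x'
  have h3 := card_union_add_card_inter (univ.filter fun y => D.adj x y)
    (univ.filter fun y => D.adj x' y)
  have h4 := card_le_univ (univ.filter (fun y => D.adj x y) ∪ univ.filter fun y => D.adj x' y)
  rw [D.card_right] at h4
  rw [← filter_and] at h3
  omega

/-- Any two left vertices outside `S i` have a common neighbour outside `S' i`. The edges to it are
covered through the second label, so all these vertices lie in one class `j`, and the covers of `i`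
and `j` together meet every edge. -/
lemma eq_second_label_of_small {i : ι} (h : ∀ x y, D.adj x y → D.r x = D.r' y → D.r x = i)
    (hS : 2 * #(D.S' i) ≤ N) : False := by
  have hcov : ∀ x y, x ∉ D.S i → y ∉ D.S' i → D.adj x y →
      D.b x = D.b' y ∧ (x ∈ D.T (D.b x) ∨ y ∈ D.T' (D.b x)) := fun x y hx hy hadj => by
    rcases D.cover x y hadj with ⟨h1, h2⟩ | h2
    · rw [h x y hadj h1] at h2
      exact absurd h2 (by simp [hx, hy])
    · exact h2
  have hlt : #(D.S i) < #(univ : Finset α) := by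
    have := D.card_S i
    have := D.add_lt
    rw [card_univ, D.card_left]
    omega
  obtain ⟨x₀, -, hx₀⟩ := exists_mem_notMem_of_card_lt_card hlt
  refine D.false_of_cover i (D.b x₀) fun x y hadj => ?_
  by_contra! hcon
  obtain ⟨⟨hx, hxT⟩, hy, hyT⟩ := hcon
  obtain ⟨z, hz, hzS⟩ := exists_mem_notMem_of_card_lt_card
    (s := D.S' i) (t := univ.filter fun y => D.adj x y ∧ D.adj x₀ y)
    (by have := D.card_common_nbrs x x₀; omega)
  simp only [mem_filter, mem_univ, true_and] at hz
  have e : D.b x = D.b x₀ :=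
    (hcov x z hx hzS hz.1).1.trans (hcov x₀ z hx₀ hzS hz.2).1.symm
  have := (hcov x y hx hy hadj).2
  rw [e] at this
  exact this.elim hxT hyT

lemma false_of_unique_class {i : ι} (h : ∀ x y, D.adj x y → D.r x = D.r' y → D.r x = i) :
    False := by
  by_cases hS : 2 * #(D.S' i) ≤ N
  · exact D.eq_second_label_of_small h hS
  · refine D.swapSides.eq_second_label_of_small (i := i) (fun y x hadj e => ?_) ?_
    · exact e.trans (h x y hadj e.symm)
    · have := D.card_S i
      have := D.add_lt
      change 2 * #(D.S i) ≤ N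
      omega

lemma exists_r_ne (i : ι) : ∃ x, D.r x ≠ i := by
  by_contra! h
  exact D.false_of_unique_class (i := i) fun x _ _ _ => h x

lemma exists_r'_ne (i : ι) : ∃ y, D.r' y ≠ i := D.swapSides.exists_r_ne i
lemma exists_b_ne (j : κ) : ∃ x, D.b x ≠ j := D.swapLabels.exists_r_ne j
lemma exists_b'_ne (j : κ) : ∃ y, D.b' y ≠ j := D.swapSides.exists_b_ne j

lemma nonempty_left : Nonempty α := by
  rw [← Fintype.card_pos_iff, D.card_left]
  exact lt_of_le_of_lt (Nat.zero_le _) D.add_lt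

lemma exists_both_ne : ∃ x x', D.r x ≠ D.r x' ∧ D.b x ≠ D.b x' := by
  obtain ⟨x₀⟩ := D.nonempty_left
  obtain ⟨x₁, h₁⟩ := D.exists_r_ne (D.r x₀)
  obtain ⟨x₂, h₂⟩ := D.exists_b_ne (D.b x₀)
  by_contra! h
  have := h x₀ x₁
  have := h x₀ x₂
  have := h x₁ x₂
  grind

/-- A common neighbour of two vertices that differ in both labels takes one label from each, which
leaves only two cells. -/
lemma exists_heavy_right : ∃ i j, N < 4 * #{y | D.r' y = i ∧ D.b' y = j} := by
  obtain ⟨x, x', hr, hb⟩ := D.exists_both_ne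
  have h1 := D.card_common_nbrs x x'
  have h2 : (univ.filter fun y => D.adj x y ∧ D.adj x' y) ⊆
      (univ.filter fun y => D.r' y = D.r x ∧ D.b' y = D.b x') ∪
        univ.filter fun y => D.r' y = D.r x' ∧ D.b' y = D.b x := fun y hy => by
    simp only [mem_filter, mem_univ, true_and, mem_union] at hy ⊢
    have := D.label_eq hy.1
    have := D.label_eq hy.2
    grind
  have h3 := (card_le_card h2).trans (card_union_le _ _)
  by_contra! h
  have h4 := h (D.r x) (D.b x')
  have h5 := h (D.r x') (D.b x)
  omega

lemma exists_heavy_left : ∃ i j, N < 4 * #{x | D.r x = i ∧ D.b x = j} :=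
  D.swapSides.exists_heavy_right

lemma label_of_heavy_right {i : ι} {j : κ} (h : N < 4 * #{y | D.r' y = i ∧ D.b' y = j}) (x : α) :
    D.r x = i ∨ D.b x = j := by
  by_contra! hx
  refine absurd (D.card_nonadj_right (x := x) fun y hy hadj => ?_) h.not_gt
  simp only [mem_filter, mem_univ, true_and] at hy
  have := D.label_eq hadj
  grind

lemma label_of_heavy_left {i : ι} {j : κ} (h : N < 4 * #{x | D.r x = i ∧ D.b x = j}) (y : β) :
    D.r' y = i ∨ D.b' y = j :=
  D.swapSides.label_of_heavy_right h y

/-- An edge avoiding both covers is not in class `i` or `j`, so its ends agree in both labels. Hence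
the neighbours of `y` outside the covers lie in one cell other than `(i, j)`. Were it heavy too, all
right vertices would share a label. -/
lemma card_compl_lt_of_common_heavy {i : ι} {j : κ}
    (hl : N < 4 * #{x | D.r x = i ∧ D.b x = j}) (hr : N < 4 * #{y | D.r' y = i ∧ D.b' y = j})
    {y : β} (hyS : y ∉ D.S' i) (hyT : y ∉ D.T' j) :
    2 * #(univ \ (D.S i ∪ D.T j)) < N := by
  have hx := D.label_of_heavy_right hr
  have hy := D.label_of_heavy_left hl
  set X := univ \ (D.S i ∪ D.T j) with hX
  have h1 : 4 * #{x ∈ X | ¬ D.adj x y} < N :=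
    D.card_nonadj_left (y := y) fun x hx => (mem_filter.1 hx).2
  have h2 := card_filter_add_card_filter_not (s := X) (fun x => D.adj x y)
  have h3 : 4 * #{x ∈ X | D.adj x y} ≤ N := by
    have hsub : ∀ x ∈ X, D.adj x y → (D.r x ≠ i ∨ D.b x ≠ j) ∧ D.r x = D.r' y ∧ D.b x = D.b' y :=
      fun x hxX hadj => by
        have := D.cover x y hadj
        have := hx x
        have := hy y
        simp only [hX, mem_sdiff, mem_univ, true_and, mem_union, not_or] at hxX
        grind
    by_contra! hlt
    have hsub' : {x ∈ X | D.adj x y} ⊆ univ.filter fun x => D.r x = D.r' y ∧ D.b x = D.b' y :=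
      fun x hx => by
        rw [mem_filter] at hx
        simpa using (hsub x hx.1 hx.2).2
    have hheavy := D.label_of_heavy_left (i := D.r' y) (j := D.b' y)
      (lt_of_lt_of_le hlt (by have := card_le_card hsub'; omega))
    obtain ⟨x, hxX⟩ := card_pos.1 (show 0 < #{x ∈ X | D.adj x y} by omega)
    rw [mem_filter] at hxX
    have := hsub x hxX.1 hxX.2
    obtain ⟨y₁, hy₁⟩ := D.exists_r'_ne i
    obtain ⟨y₂, hy₂⟩ := D.exists_b'_ne j
    have := hheavy y₁
    have := hheavy y₂
    have := hy y₁
    have := hy y₂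
    have := hy y
    grind
  omega

lemma false_of_common_heavy {i : ι} {j : κ}
    (hl : N < 4 * #{x | D.r x = i ∧ D.b x = j}) (hr : N < 4 * #{y | D.r' y = i ∧ D.b' y = j}) :
    False := by
  have h1 := le_card_sdiff (D.S i ∪ D.T j) univ
  have h2 := le_card_sdiff (D.S' i ∪ D.T' j) univ
  rw [card_univ, D.card_left] at h1
  rw [card_univ, D.card_right] at h2
  have := card_union_le (D.S i) (D.T j)
  have := card_union_le (D.S' i) (D.T' j)
  have := D.card_S i
  have := D.card_T j
  have := D.add_lt
  obtain ⟨x, hx⟩ := card_pos.1 (show 0 < #(univ \ (D.S i ∪ D.T j)) by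
    have := card_le_univ (D.S' i ∪ D.T' j); rw [D.card_right] at this; omega)
  obtain ⟨y, hy⟩ := card_pos.1 (show 0 < #(univ \ (D.S' i ∪ D.T' j)) by
    have := card_le_univ (D.S i ∪ D.T j); rw [D.card_left] at this; omega)
  simp only [mem_sdiff, mem_univ, true_and, mem_union, not_or] at hx hy
  have h3 := D.card_compl_lt_of_common_heavy hl hr hy.1 hy.2
  have h4 : 2 * #(univ \ (D.S' i ∪ D.T' j)) < N :=
    D.swapSides.card_compl_lt_of_common_heavy hr hl hx.1 hx.2
  omega

end CoveredBigraph
end Core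

/-! ### Heavy cells sharing exactly one label -/

section Cross
open Classical

namespace CoveredBigraph

variable {α β ι κ : Type*} [Fintype α] [Fintype β] {N s t : ℕ}

/-- The left vertices whose first label is not `i`. -/
noncomputable def outside (D : CoveredBigraph α β ι κ N s t) (i : ι) : Finset α := {x | D.r x ≠ i}

/-- The left vertices with labels `i` and `j`. -/
noncomputable def cell (D : CoveredBigraph α β ι κ N s t) (i : ι) (j : κ) :
    Finset α := {x | D.r x = i ∧ D.b x = j}

/-- The left vertices whose first label is `i` and whose second label is not `j`. -/
noncomputable def rest (D : CoveredBigraph α β ι κ N s t) (i : ι) (j : κ) :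
    Finset α := {x | D.r x = i ∧ D.b x ≠ j}

/-- There are heavy cells `(i, j₂)` on the left and `(i, j₁)` on the right, sharing the first label
only. -/
structure CrossHeavy (D : CoveredBigraph α β ι κ N s t) (i : ι) (j₁ j₂ : κ) : Prop where
  ne : j₁ ≠ j₂
  left : N < 4 * #(D.cell i j₂)
  right : N < 4 * #(D.swapSides.cell i j₁)

lemma card_outside_add (D : CoveredBigraph α β ι κ N s t) (i : ι) (j : κ) :
    #(D.outside i) + #(D.cell i j) + #(D.rest i j) = N := by
  have h1 := card_filter_add_card_filter_not (s := (univ : Finset α)) (fun x => D.r x = i)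
  have h2 := card_filter_add_card_filter_not (s := univ.filter fun x => D.r x = i)
    (fun x => D.b x = j)
  rw [filter_filter, filter_filter] at h2
  rw [card_univ, D.card_left] at h1
  unfold outside cell rest
  simp only [ne_eq]
  omega

lemma card_right_cell_le (D : CoveredBigraph α β ι κ N s t) (i : ι) (j : κ)
    (h : N ≤ 2 * #(D.swapSides.cell i j)) :
    #(D.swapSides.cell i j) ≤ #(D.S' i) + #(D.T' j) := by
  have h1 := D.card_le_or_card_le_or_lt (P := univ) (Q := D.swapSides.cell i j)
    (U := D.S i ∪ D.T j) (U' := D.S' i ∪ D.T' j) (fun x _ y hy hadj => by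
      change y ∈ univ.filter fun y => D.r' y = i ∧ D.b' y = j at hy
      simp only [mem_filter, mem_univ, true_and] at hy
      have := D.cover x y hadj
      simp only [mem_union]
      grind)
  rw [card_univ, D.card_left] at h1
  have := card_union_le (D.S i) (D.T j)
  have := card_union_le (D.S' i) (D.T' j)
  have := D.card_S i
  have := D.card_T j
  have := D.add_lt
  omega

namespace CrossHeavy

variable {D : CoveredBigraph α β ι κ N s t} {i : ι} {j₁ j₂ : κ} (H : D.CrossHeavy i j₁ j₂)
include H

lemma swap : D.swapSides.CrossHeavy i j₂ j₁ := ⟨H.ne.symm, H.right, H.left⟩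

lemma label_left (x : α) : D.r x = i ∨ D.b x = j₁ := D.label_of_heavy_right H.right x

lemma label_right (y : β) : D.r' y = i ∨ D.b' y = j₂ := D.label_of_heavy_left H.left y

lemma rest_small : 4 * #(D.rest i j₂) < N := by
  obtain ⟨y, hy⟩ := D.exists_r'_ne i
  refine D.card_nonadj_left (y := y) fun x hx hadj => ?_
  simp only [rest, mem_filter, mem_univ, true_and] at hx
  have := H.label_right y
  have := D.label_eq hadj
  grind

lemma outside_right_small (h : #(D.rest i j₂) ≠ 0) : 4 * #(D.swapSides.outside i) < N := by
  obtain ⟨x, hx⟩ := card_pos.1 (Nat.pos_of_ne_zero h)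
  refine D.card_nonadj_right (x := x) fun y hy hadj => ?_
  simp only [rest, mem_filter, mem_univ, true_and] at hx
  change y ∈ univ.filter fun y => D.r' y ≠ i at hy
  simp only [mem_filter, mem_univ, true_and] at hy
  have := H.label_right y
  have := D.label_eq hadj
  grind

lemma cell_cell : D.cell i j₂ ⊆ D.S i ∨ D.swapSides.cell i j₁ ⊆ D.S' i ∨
    4 * #(D.cell i j₂) + 4 * #(D.swapSides.cell i j₁) < 4 * #(D.S i) + 4 * #(D.S' i) + 2 * N := by
  refine D.subset_or_subset_or_lt fun x hx y hy hadj => ?_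
  change y ∈ univ.filter fun y => D.r' y = i ∧ D.b' y = j₁ at hy
  simp only [cell, mem_filter, mem_univ, true_and] at hx hy
  have := D.cover x y hadj
  have := H.ne
  grind

lemma outside_cell : D.outside i ⊆ D.T j₁ ∨ D.swapSides.cell i j₁ ⊆ D.T' j₁ ∨
    4 * #(D.outside i) + 4 * #(D.swapSides.cell i j₁) <
      4 * #(D.T j₁) + 4 * #(D.T' j₁) + 2 * N := by
  refine D.subset_or_subset_or_lt fun x hx y hy hadj => ?_
  change y ∈ univ.filter fun y => D.r' y = i ∧ D.b' y = j₁ at hy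
  simp only [outside, mem_filter, mem_univ, true_and] at hx hy
  have := D.cover x y hadj
  have := H.label_left x
  grind

/-- Outside class `i` the second labels are `j₁` on the left and `j₂` on the right, so edges there
preserve the first label. Two different labels on the left would each exclude all but fewer than `N
/ 4` vertices of a set of at least `N / 2`. -/
lemma eq_of_outside (h : N ≤ 2 * #(D.swapSides.outside i)) {x x' : α} (hx : x ∈ D.outside i)
    (hx' : x' ∈ D.outside i) : D.r x = D.r x' := by
  by_contra hne
  simp only [outside, mem_filter, mem_univ, true_and] at hx hx'
  have key : ∀ z, D.r z ≠ i →
      4 * #{y ∈ D.swapSides.outside i | D.r' y ≠ D.r z} < N := fun z hz =>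
    D.card_nonadj_right (x := z) fun y hy hadj => by
      rw [mem_filter] at hy
      have h0 : y ∈ univ.filter fun y => D.r' y ≠ i := hy.1
      simp only [mem_filter, mem_univ, true_and] at h0
      have := H.label_left z
      have := H.label_right y
      have := D.label_eq hadj
      have := H.ne
      grind
  have h1 := key x hx
  have h2 := key x' hx'
  have h3 : D.swapSides.outside i ⊆ {y ∈ D.swapSides.outside i | D.r' y ≠ D.r x} ∪
      {y ∈ D.swapSides.outside i | D.r' y ≠ D.r x'} := fun y hy => by
    simp only [mem_union, mem_filter]
    grind
  have h4 := (card_le_card h3).trans (card_union_le _ _)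
  omega

lemma outside_outside (h : N ≤ 2 * #(D.outside i) ∨ N ≤ 2 * #(D.swapSides.outside i)) :
    ∃ k, #(D.outside i) ≤ #(D.S k) ∨ #(D.swapSides.outside i) ≤ #(D.S' k) ∨
      4 * #(D.outside i) + 4 * #(D.swapSides.outside i) <
        4 * #(D.S k) + 4 * #(D.S' k) + 2 * N := by
  suffices ∃ k, ∀ x ∈ D.outside i, ∀ y ∈ D.swapSides.outside i, D.adj x y → D.r x = k by
    obtain ⟨k, hk⟩ := this
    refine ⟨k, D.card_le_or_card_le_or_lt fun x hx y hy hadj => ?_⟩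
    have e := hk x hx y hy hadj
    change y ∈ univ.filter fun y => D.r' y ≠ i at hy
    simp only [outside, mem_filter, mem_univ, true_and] at hx hy
    have := D.cover x y hadj
    have := H.label_left x
    have := H.label_right y
    have := H.ne
    grind
  rcases h with h | h
  · obtain ⟨y₀, hy₀⟩ := D.exists_r'_ne i
    refine ⟨D.r' y₀, fun x hx y hy hadj => ?_⟩
    have e : D.r' y = D.r' y₀ := H.swap.eq_of_outside h hy (by
      change y₀ ∈ univ.filter fun y => D.r' y ≠ i
      simpa using hy₀)
    change y ∈ univ.filter fun y => D.r' y ≠ i at hy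
    simp only [outside, mem_filter, mem_univ, true_and] at hx hy
    have := D.label_eq hadj
    have := H.label_left x
    have := H.label_right y
    have := H.ne
    grind
  · obtain ⟨x₀, hx₀⟩ := D.exists_r_ne i
    exact ⟨D.r x₀, fun x hx y hy hadj => H.eq_of_outside h hx (by simpa [outside] using hx₀)⟩

/-! ### The second labels have small covers -/

lemma false_of_rest_eq_zero_of_le (ht : 2 * t < N) (he : #(D.rest i j₂) = 0)
    (hf : #(D.swapSides.rest i j₁) = 0)
    (hle : #(D.swapSides.cell i j₁) ≤ #(D.cell i j₂)) : False := by
  have h1 := D.card_outside_add i j₂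
  have h2 := D.swapSides.card_outside_add i j₁
  have h3 : D.swapSides.outside i ⊆ D.T' j₂ ∨ D.cell i j₂ ⊆ D.T j₂ ∨
    4 * #(D.swapSides.outside i) + 4 * #(D.cell i j₂) <
      4 * #(D.T' j₂) + 4 * #(D.T j₂) + 2 * N := H.swap.outside_cell
  have h4 := D.card_T j₂
  have h5 := D.add_lt
  rcases h3 with h3 | h3 | h3
  · have := card_le_card h3
    have := H.cell_cell.imp card_le_card (Or.imp_left card_le_card)
    have := D.card_S i
    omega
  · have := card_le_card h3
    obtain ⟨k, hk⟩ := H.outside_outside (Or.inl (by omega))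
    have := D.card_S k
    omega
  · omega

/-- An uncovered `x` has no neighbour in the right rest or in the uncovered part of the right cell,
yet the outside block and `T' j₁` are too small to hold all other vertices. -/
lemma outside_subset_of_small (ht : 2 * t < N) (hb : 4 * #(D.swapSides.outside i) < N) :
    #(D.outside i) ≤ #(D.T j₁) := by
  have h2 := D.swapSides.card_outside_add i j₁
  have h3 : 4 * #(D.swapSides.rest i j₁) < N := H.swap.rest_small
  refine card_le_card fun x hx => ?_
  by_contra hxT
  have h4 : 4 * #(D.swapSides.rest i j₁ ∪ (D.swapSides.cell i j₁ \ D.T' j₁)) < N := by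
    refine D.card_nonadj_right (x := x) fun y hy hadj => ?_
    have hy' : (D.r' y = i ∧ D.b' y ≠ j₁) ∨ (D.r' y = i ∧ D.b' y = j₁) ∧ y ∉ D.T' j₁ := by
      change y ∈ (univ.filter fun y => D.r' y = i ∧ D.b' y ≠ j₁) ∪
        ((univ.filter fun y => D.r' y = i ∧ D.b' y = j₁) \ D.T' j₁) at hy
      simpa using hy
    simp only [outside, mem_filter, mem_univ, true_and] at hx
    have := D.cover x y hadj
    have := H.label_left x
    grind
  have h5 : Disjoint (D.swapSides.rest i j₁) (D.swapSides.cell i j₁ \ D.T' j₁) := by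
    rw [Finset.disjoint_left]
    intro y hy hy'
    simp only [rest, cell, mem_sdiff, mem_filter] at hy hy'
    exact hy.2.2 hy'.1.2.2
  rw [card_union_of_disjoint h5] at h4
  have h6 := le_card_sdiff (D.T' j₁) (D.swapSides.cell i j₁)
  have := D.card_T j₁
  omega

lemma false_of_rest_ne_zero (ht : 2 * t < N) (he : #(D.rest i j₂) ≠ 0) : False := by
  have hb := H.outside_right_small he
  have ha1 := H.outside_subset_of_small ht hb
  have h1 := D.card_outside_add i j₂
  have h2 := D.swapSides.card_outside_add i j₁
  have he4 := H.rest_small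
  have hf4 : 4 * #(D.swapSides.rest i j₁) < N := H.swap.rest_small
  have hq := D.card_right_cell_le i j₁ (by omega)
  have hS := D.card_S i
  have hT1 := D.card_T j₁
  have hT2 := D.card_T j₂
  have hst := D.add_lt
  have ha : 4 * #(D.outside i) < N := by
    by_cases hf : #(D.swapSides.rest i j₁) = 0
    · omega
    · exact H.swap.outside_right_small hf
  have hb1 : #(D.swapSides.outside i) ≤ #(D.T' j₂) := H.swap.outside_subset_of_small ht ha
  have hp : #(D.cell i j₂) ≤ #(D.S i) + #(D.T j₂) :=
    D.swapSides.card_right_cell_le i j₂ (by change N ≤ 2 * #(D.cell i j₂); omega)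
  -- The blocks outside the two rests total at most `s + 2 * t < 3 * N / 2`, and each rest is below
  -- `N / 4`.
  omega

lemma false_of_second_small (ht : 2 * t < N) : False := by
  by_cases he : #(D.rest i j₂) = 0
  · by_cases hf : #(D.swapSides.rest i j₁) = 0
    · rcases le_total #(D.swapSides.cell i j₁) #(D.cell i j₂) with h | h
      · exact H.false_of_rest_eq_zero_of_le ht he hf h
      · exact H.swap.false_of_rest_eq_zero_of_le ht hf he h
    · exact H.swap.false_of_rest_ne_zero ht hf
  · exact H.false_of_rest_ne_zero ht he

/-! ### The first label has small covers -/

lemma false_of_rest_eq_zero (hs : 2 * s < N) (he : #(D.rest i j₂) = 0)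
    (hf : #(D.swapSides.rest i j₁) = 0) : False := by
  have h1 := D.card_outside_add i j₂
  have h2 := D.swapSides.card_outside_add i j₁
  have h3 : #(D.swapSides.outside i) ≤ #(D.T' j₂) ∨ #(D.cell i j₂) ≤ #(D.T j₂) ∨
    4 * #(D.swapSides.outside i) + 4 * #(D.cell i j₂) <
      4 * #(D.T' j₂) + 4 * #(D.T j₂) + 2 * N :=
    H.swap.outside_cell.imp card_le_card (Or.imp_left card_le_card)
  have h4 := H.outside_cell.imp card_le_card (Or.imp_left card_le_card)
  have h5 := H.cell_cell.imp card_le_card (Or.imp_left card_le_card)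
  have hS := D.card_S i
  have hT1 := D.card_T j₁
  have hT2 := D.card_T j₂
  have hst := D.add_lt
  -- Large cells make `cell_cell` put one cell inside a cover; otherwise the outside blocks are
  -- large and `outside_outside` does the same for them.
  by_cases h : N ≤ #(D.cell i j₂) + #(D.swapSides.cell i j₁)
  · omega
  · obtain ⟨k, hk⟩ := H.outside_outside (by omega)
    have := D.card_S k
    omega

lemma false_of_rest_ne_zero' (hs : 2 * s < N) (he : #(D.rest i j₂) ≠ 0) : False := by
  have hb := H.outside_right_small he
  have h1 := D.card_outside_add i j₂
  have h2 := D.swapSides.card_outside_add i j₁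
  have he4 := H.rest_small
  have hf4 : 4 * #(D.swapSides.rest i j₁) < N := H.swap.rest_small
  have hS := D.card_S i
  have hT1 := D.card_T j₁
  have hst := D.add_lt
  have hp := H.left
  by_cases hf : #(D.swapSides.rest i j₁) = 0
  · have hq := D.card_right_cell_le i j₁ (by omega)
    -- The right cell exceeds `3 * N / 4`, so over `N / 4` of it lies outside `S' i`, and an
    -- uncovered `x` would miss all of that.
    have : D.cell i j₂ ⊆ D.S i := by
      intro x hx
      by_contra hxS
      have h4 : 4 * #(D.swapSides.cell i j₁ \ D.S' i) < N := by
        refine D.card_nonadj_right (x := x) fun y hy hadj => ?_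
        have hy' : (D.r' y = i ∧ D.b' y = j₁) ∧ y ∉ D.S' i := by
          change y ∈ (univ.filter fun y => D.r' y = i ∧ D.b' y = j₁) \ D.S' i at hy
          simpa using hy
        simp only [cell, mem_filter, mem_univ, true_and] at hx
        have := D.cover x y hadj
        have := H.ne
        grind
      have h6 := le_card_sdiff (D.S' i) (D.swapSides.cell i j₁)
      omega
    have := card_le_card this
    omega
  · have ha : 4 * #(D.outside i) < N := H.swap.outside_right_small hf
    have := H.cell_cell.imp card_le_card (Or.imp_left card_le_card)
    omega

lemma false_of_first_small (hs : 2 * s < N) : False := by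
  by_cases he : #(D.rest i j₂) = 0
  · by_cases hf : #(D.swapSides.rest i j₁) = 0
    · exact H.false_of_rest_eq_zero hs he hf
    · exact H.swap.false_of_rest_ne_zero' hs hf
  · exact H.false_of_rest_ne_zero' hs he

end CrossHeavy

theorem false_of_two_mul_lt (D : CoveredBigraph α β ι κ N s t) (ht : 2 * t < N) : False := by
  obtain ⟨i, j, hr⟩ := D.exists_heavy_right
  obtain ⟨i', j', hl⟩ := D.exists_heavy_left
  obtain ⟨x, hx⟩ := card_pos.1 (show 0 < #{x | D.r x = i' ∧ D.b x = j'} by omega)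
  simp only [mem_filter, mem_univ, true_and] at hx
  have h := D.label_of_heavy_right hr x
  rw [hx.1, hx.2] at h
  by_cases hi : i' = i
  · subst hi
    by_cases hj : j' = j
    · subst hj
      exact D.false_of_common_heavy hl hr
    · exact CrossHeavy.false_of_second_small (D := D) ⟨Ne.symm hj, hl, hr⟩ ht
  · obtain rfl := h.resolve_left hi
    -- Exchanging the labels makes the shared one first, and the bound `t` now belongs to it.
    refine CrossHeavy.false_of_first_small (D := D.swapLabels) (i := j') (j₁ := i) (j₂ := i')
      ⟨Ne.symm hi, ?_, ?_⟩ ht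
    · change N < 4 * #{x | D.b x = j' ∧ D.r x = i'}
      simpa only [and_comm] using hl
    · change N < 4 * #{y | D.b' y = j' ∧ D.r' y = i}
      simpa only [and_comm] using hr

end CoveredBigraph
end Cross

/-! ### König's theorem and covers of components -/

section Koenig
open Classical

/-- König's theorem, in the form of an alternative: a relation between finite types has a matching
of `k` pairs or a vertex cover of fewer than `k` vertices. -/
theorem exists_matching_or_exists_cover {α β : Type*} [Fintype α] [Fintype β] (R : α → β → Prop)
    (k : ℕ) :
    (∃ M : Finset (α × β), #M = k ∧ (∀ p ∈ M, R p.1 p.2) ∧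
      (∀ p ∈ M, ∀ q ∈ M, p.1 = q.1 → p = q) ∧ ∀ p ∈ M, ∀ q ∈ M, p.2 = q.2 → p = q) ∨
    ∃ (S : Finset α) (S' : Finset β), #S + #S' < k ∧ ∀ x y, R x y → x ∈ S ∨ y ∈ S' := by
  by_cases hk : Fintype.card α < k
  · exact Or.inr ⟨univ, ∅, by simpa using hk, by simp⟩
  push Not at hk
  -- Hall's theorem is applied after adding `card α - k` dummy vertices joined to all of `α`: a
  -- saturating matching uses at least `k` real edges.
  let nb : α → Finset (β ⊕ Fin (Fintype.card α - k)) := fun x => disjSum {y | R x y} univ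
  by_cases hall : ∀ X : Finset α, #X ≤ #(X.biUnion nb)
  · left
    obtain ⟨f, hf, hmem⟩ := (all_card_le_biUnion_card_iff_exists_injective nb).1 hall
    let M₀ : Finset (α × β) := {p | f p.1 = Sum.inl p.2}
    have hM₀ : ∀ p ∈ M₀, f p.1 = Sum.inl p.2 := fun p hp => (mem_filter.1 hp).2
    have hcard : k ≤ #M₀ := by
      have h1 : univ ⊆ M₀.image Prod.fst ∪ univ.filter fun x => (f x).isRight := fun x _ => by
        rw [mem_union]
        cases e : f x with
        | inl y => exact Or.inl (mem_image.2 ⟨(x, y), by simp [M₀, e], rfl⟩)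
        | inr c => exact Or.inr (by simp [e])
      have h2 : #(univ.filter fun x => (f x).isRight) ≤ Fintype.card α - k := by
        have : (univ.filter fun x => (f x).isRight).image f ⊆
            (univ : Finset (Fin (Fintype.card α - k))).image Sum.inr := fun z hz => by
          obtain ⟨x, hx, rfl⟩ := mem_image.1 hz
          obtain ⟨c, hc⟩ := Sum.isRight_iff.1 (mem_filter.1 hx).2
          simp [hc]
        have := card_le_card this
        rw [card_image_of_injective _ hf] at this
        simpa using this.trans card_image_le
      have h3 := (card_le_card h1).trans (card_union_le _ _)
      have h4 := card_image_le (s := M₀) (f := Prod.fst)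
      rw [card_univ] at h3
      omega
    obtain ⟨M, hM, hMk⟩ := exists_subset_card_eq hcard
    refine ⟨M, hMk, fun p hp => ?_, fun p hp q hq e => ?_, fun p hp q hq e => ?_⟩
    · have := hmem p.1
      rw [hM₀ p (hM hp)] at this
      simpa [nb] using this
    · have h1 := hM₀ p (hM hp)
      rw [e, hM₀ q (hM hq)] at h1
      exact Prod.ext e (Sum.inl_injective h1).symm
    · refine Prod.ext (hf ?_) e
      rw [hM₀ p (hM hp), hM₀ q (hM hq), e]
  · right
    push Not at hall
    obtain ⟨X, hX⟩ := hall
    have h1 : (X.biUnion fun x => univ.filter (R x)).disjSum univ ⊆ X.biUnion nb ∨ X = ∅ := by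
      rcases X.eq_empty_or_nonempty with rfl | ⟨x₀, hx₀⟩
      · exact Or.inr rfl
      · refine Or.inl fun z hz => ?_
        cases z with
        | inl y => simpa [nb] using hz
        | inr c => simpa [nb] using ⟨x₀, hx₀⟩
    rcases h1 with h1 | rfl
    · have h2 := card_le_card h1
      rw [card_disjSum, card_univ, Fintype.card_fin] at h2
      -- For a Hall violator `X`, the complement of `X` and the real neighbours of `X` form the
      -- cover.
      refine ⟨univ \ X, X.biUnion fun x => univ.filter (R x), ?_, fun x y hxy => ?_⟩
      · rw [card_sdiff_of_subset (subset_univ _), card_univ]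
        have := card_le_univ X
        omega
      · by_cases hx : x ∈ X
        · exact Or.inr (mem_biUnion.2 ⟨x, hx, by simpa using hxy⟩)
        · exact Or.inl (by simpa using hx)
    · simp at hX

/-- In a bipartite graph, a component without a matching of `k` edges has its edges covered by
fewer than `k` vertices. -/
lemma exists_cover_of_not_hasConnectedMatching {V : Type*} {V₁ V₂ : Finset V}
    {H : SimpleGraph V} (hdisj : Disjoint V₁ V₂) {k : ℕ} (h : ¬ HasConnectedMatching H k)
    (C : H.ConnectedComponent) :
    ∃ (S : Finset V₁) (S' : Finset V₂), #S + #S' < k ∧ ∀ (x : V₁) (y : V₂),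
      H.Adj x y → H.connectedComponentMk x = C → x ∈ S ∨ y ∈ S' := by
  rcases exists_matching_or_exists_cover
    (fun (x : V₁) (y : V₂) => H.Adj x y ∧ H.connectedComponentMk x = C) k with
    ⟨M, hMk, hM, hM₁, hM₂⟩ | ⟨S, S', hS, hcov⟩
  · refine absurd ⟨C, ?_⟩ h
    have hne : ∀ (x : V₁) (y : V₂), (x : V) ≠ y := fun x y e =>
      Finset.disjoint_left.1 hdisj x.2 (e ▸ y.2)
    let P : V → V → Prop := fun u v => ∃ p ∈ M, (p.1 : V) = u ∧ (p.2 : V) = v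
    let K : H.Subgraph :=
      { verts := {v | ∃ w, P v w ∨ P w v}
        Adj := fun u v => P u v ∨ P v u
        adj_sub := by
          rintro u v (⟨p, hp, rfl, rfl⟩ | ⟨p, hp, rfl, rfl⟩)
          exacts [(hM p hp).1, (hM p hp).1.symm]
        edge_vert := fun h => ⟨_, h⟩
        symm := ⟨fun _ _ h => h.symm⟩ }
    refine ⟨K, ?_, ?_, ?_⟩
    · rintro v ⟨w, hw⟩
      refine ⟨w, hw, fun w' hw' => ?_⟩
      rcases hw with ⟨p, hp, rfl, rfl⟩ | ⟨p, hp, rfl, rfl⟩ <;>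
        rcases hw' with ⟨q, hq, e, rfl⟩ | ⟨q, hq, rfl, e⟩
      · rw [hM₁ p hp q hq (Subtype.ext e.symm)]
      · exact absurd e.symm (hne _ _)
      · exact absurd e (hne _ _)
      · rw [hM₂ p hp q hq (Subtype.ext e.symm)]
    · have hE : K.edgeSet = ((M.image fun p => s((p.1 : V), (p.2 : V)) : Finset (Sym2 V)) :
          Set (Sym2 V)) := by
        ext e
        induction e using Sym2.ind with
        | _ u v =>
          rw [SimpleGraph.Subgraph.mem_edgeSet]
          simp only [coe_image, Set.mem_image, mem_coe, Sym2.eq_iff, K, P]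
          grind
      rw [hE, Set.encard_coe_eq_coe_finsetCard, card_image_of_injOn, hMk]
      intro p hp q hq e
      rcases Sym2.eq_iff.1 e with ⟨e, -⟩ | ⟨e, -⟩
      · exact hM₁ p hp q hq (Subtype.ext e)
      · exact absurd e (hne _ _)
    · rintro v ⟨w, ⟨p, hp, rfl, rfl⟩ | ⟨p, hp, rfl, rfl⟩⟩
      · exact (hM p hp).2
      · exact (SimpleGraph.ConnectedComponent.sound (hM p hp).1.symm.reachable).trans (hM p hp).2
  · exact ⟨S, S', hS, fun x y hxy hC => hcov x y ⟨hxy, hC⟩⟩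

end Koenig

/-! ### From edge-colourings to covered bigraphs -/

lemma card_filter_adj_of_isBipartiteWith {V : Type*} [Fintype V] {G : SimpleGraph V}
    [DecidableRel G.Adj] {V₁ V₂ : Finset V} (hbip : G.IsBipartiteWith (V₁ : Set V) (V₂ : Set V))
    {x : V} (hx : x ∈ V₁) : #{y : V₂ | G.Adj x y} = G.degree x := by
  classical
  rw [← G.card_neighborFinset_eq_degree]
  refine card_bij (fun y _ => (y : V)) (fun y hy => by simpa using hy)
    (fun y _ z _ e => Subtype.ext e) fun y hy => ?_
  rw [SimpleGraph.mem_neighborFinset] at hy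
  exact ⟨⟨y, hbip.mem_of_mem_adj hx hy⟩, by simpa using hy, rfl⟩

theorem theorem1 {V : Type*} [Fintype V] [DecidableEq V] (G : SimpleGraph V) [DecidableRel G.Adj]
    (V₁ V₂ : Finset V) (m n : ℕ) (hn : 1 ≤ n) (hmn : n < m)
    (hbip : G.IsBipartiteWith (V₁ : Set V) (V₂ : Set V))
    (hcover : V₁ ∪ V₂ = Finset.univ)
    (hV₁ : V₁.card = m + n - 1) (hV₂ : V₂.card = m + n - 1)
    (hdeg : (3 / 4 : ℝ) * ((m : ℝ) + (n : ℝ) - 1) < (G.minDegree : ℝ)) :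
    ArrowsConnectedMatchings G m n := by
  classical
  intro c
  by_contra! hcon
  have hdisj : Disjoint V₁ V₂ := by exact_mod_cast hbip.disjoint
  have hdeg' : 3 * (m + n - 1) < 4 * G.minDegree := by
    have h1 : 3 * (m + n) < 4 * G.minDegree + 3 := by
      have : (3 : ℝ) * (m + n) < 4 * G.minDegree + 3 := by linarith
      exact_mod_cast this
    omega
  choose S S' hS hSc using exists_cover_of_not_hasConnectedMatching hdisj hcon.1
  choose T T' hT hTc using exists_cover_of_not_hasConnectedMatching hdisj hcon.2
  refine CoveredBigraph.false_of_two_mul_lt (N := m + n - 1) (s := m - 1) (t := n - 1)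
    { adj := fun (x : V₁) (y : V₂) => G.Adj x y
      r := fun x => (c.labelGraph EdgeColor.red).connectedComponentMk x
      r' := fun x => (c.labelGraph EdgeColor.red).connectedComponentMk x
      b := fun x => (c.labelGraph EdgeColor.blue).connectedComponentMk x
      b' := fun x => (c.labelGraph EdgeColor.blue).connectedComponentMk x
      S := S
      S' := S'
      T := T
      T' := T'
      card_left := by simpa using hV₁
      card_right := by simpa using hV₂
      deg_left := fun x => ?_
      deg_right := fun y => ?_
      card_S := fun i => by have := hS i; omega
      card_T := fun j => by have := hT j; omega
      add_lt := by omega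
      cover := fun x y hxy => ?_ } (by omega)
  · have h := card_filter_adj_of_isBipartiteWith hbip x.2
    have := G.minDegree_le_degree x
    convert (show 3 * (m + n - 1) < 4 * G.degree x by omega) using 2
    convert h
  · have h := card_filter_adj_of_isBipartiteWith hbip.symm y.2
    have := G.minDegree_le_degree y
    simp only [G.adj_comm] at h ⊢
    convert (show 3 * (m + n - 1) < 4 * G.degree y by omega) using 2
  · cases hc : c ⟨s(x, y), hxy⟩ with
    | red =>
      have hadj : (c.labelGraph EdgeColor.red).Adj x y :=
        (SimpleGraph.EdgeLabeling.labelGraph_adj ..).2 ⟨hxy, hc⟩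
      exact Or.inl ⟨SimpleGraph.ConnectedComponent.sound hadj.reachable, hSc _ x y hadj rfl⟩
    | blue =>
      have hadj : (c.labelGraph EdgeColor.blue).Adj x y :=
        (SimpleGraph.EdgeLabeling.labelGraph_adj ..).2 ⟨hxy, hc⟩
      exact Or.inr ⟨SimpleGraph.ConnectedComponent.sound hadj.reachable, hTc _ x y hadj rfl⟩
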